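/- Let $\mathcal H$ be a class of probability distribution functions on $\mathbb R$ such that $\int_{\mathbb R} x\,H\{dx\}=0$ and $\int_{\mathbb R} x^2\,H\{dx\}=1$ for all $H\in\mathcal H$, and $\lim_{c\to\infty}\sup_{H\in\mathcal H}\int_{|x|>c}x^2\,H\{dx\}=0$. Then for every $\epsilon>0$ there is $\kappa=\kappa(\epsilon,\mathcal H)>0$, depending only on $\epsilon$ and $\mathcal H$, with the following property. Let $F\in\mathcal H$, let $\xi_{r,s}$ $(r,s\in\mathbb Z)$ be independent random variables with common distribution function $F$ on a probability space $(\Omega,\mathcal A,P)$, let $\mathbf a=(a_{r,s})_{r,s\in\mathbb Z}$ be a real array with $\Vert\mathbf a\Vert_1=\sum_{r,s\in\mathbb Z}|a_{r,s}|<\infty$, and let $\Gamma\subset\mathbb Z^2$ be finite. Put $$X_{j,k}=\sum_{r\in\mathbb Z}\sum_{s\in\mathbb Z}a_{r,s}\,\xi_{j-r,k-s},\qquad S=\sum_{(j,k)\in\Gamma}X_{j,k},\qquad \sigma=\sqrt{E(S^2)},$$ and suppose that $\sigma>0$. Let $G(z)=P[S/\sigma\le z]$ for $z\in\mathbb R$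 and let $\Phi$ be the standard normal distribution function. If $\sigma\ge\kappa\Vert\mathbf a\Vert_1$, then $$\sup_{z\in\mathbb R}|G(z)-\Phi(z)|\le\epsilon .$$ -/

import Mathlib

open MeasureTheory ProbabilityTheory Filter Topology

namespace LinearField

/-- A right-continuous nondecreasing function is a (probability) distribution function when it
tends to `0` at `-∞` and to `1` at `+∞`. The measure `H{dx}` is then `H.measure`. -/
def IsDistributionFunction (H : StieltjesFunction ℝ) : Prop :=
  Tendsto H atBot (𝓝 0) ∧ Tendsto H atTop (𝓝 1)

/-- The integral of `x ^ 2` over `|x| > c` with respect to `H{dx}`, valued in `[0, ∞]`. -/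
noncomputable def tailSecondMoment (H : StieltjesFunction ℝ) (c : ℝ) : ENNReal :=
  ∫⁻ x in {x : ℝ | c < |x|}, ENNReal.ofReal (x ^ 2) ∂H.measure

/-- The hypotheses on a class of distribution functions: mean `0`, variance `1`, and uniformly
integrable squares. (A second moment equal to `1` forces `x ^ 2`, hence also `x`, to be
integrable.) -/
structure IsStandardizedUniformClass (𝓗 : Set (StieltjesFunction ℝ)) : Prop where
  isDistributionFunction : ∀ H ∈ 𝓗, IsDistributionFunction H
  mean_eq_zero : ∀ H ∈ 𝓗, ∫ x, x ∂H.measure = 0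
  second_moment_eq_one : ∀ H ∈ 𝓗, ∫ x, x ^ 2 ∂H.measure = 1
  tendsto_tail : Tendsto (fun c : ℝ => ⨆ H ∈ 𝓗, tailSecondMoment H c) atTop (𝓝 0)

/-- The `ℓ¹` norm of an array (used for summable arrays only). -/
noncomputable def l1Norm (a : ℤ × ℤ → ℝ) : ℝ := ∑' p, |a p|

variable {Ω : Type*} [MeasurableSpace Ω]

/-- The innovations are independent random variables with common distribution function `F`. -/
structure IsIIDWith (ξ : ℤ × ℤ → Ω → ℝ) (F : StieltjesFunction ℝ) (P : Measure Ω) : Prop where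
  measurable : ∀ p, Measurable (ξ p)
  indep : iIndepFun ξ P
  distribution : ∀ p, cdf (P.map (ξ p)) = F

/-- The linear field `X (j, k) = ∑ r s, a (r, s) * ξ (j - r, k - s)`. For summable `a` and
innovations with a finite first moment, the series converges absolutely almost surely. -/
noncomputable def field (a : ℤ × ℤ → ℝ) (ξ : ℤ × ℤ → Ω → ℝ) (q : ℤ × ℤ) (ω : Ω) : ℝ :=
  ∑' p : ℤ × ℤ, a p * ξ (q - p) ω

/-- The sum `S` of the field over the finite region `Γ`. -/
noncomputable def S (a : ℤ × ℤ → ℝ) (Γ : Finset (ℤ × ℤ)) (ξ : ℤ × ℤ → Ω → ℝ) (ω : Ω) : ℝ :=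
  ∑ q ∈ Γ, field a ξ q ω

/-- The standard deviation `σ = √(E (S ^ 2))`. -/
noncomputable def sigma (a : ℤ × ℤ → ℝ) (Γ : Finset (ℤ × ℤ)) (ξ : ℤ × ℤ → Ω → ℝ)
    (P : Measure Ω) : ℝ :=
  √(∫ ω, S a Γ ξ ω ^ 2 ∂P)

/-- The distribution function `G z = P [S / σ ≤ z]` of the normalized sum. -/
noncomputable def G (a : ℤ × ℤ → ℝ) (Γ : Finset (ℤ × ℤ)) (ξ : ℤ × ℤ → Ω → ℝ)
    (P : Measure Ω) (z : ℝ) : ℝ :=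
  P.real {ω | S a Γ ξ ω / sigma a Γ ξ P ≤ z}

/-- The standard normal distribution function. -/
noncomputable def Phi (z : ℝ) : ℝ := cdf (gaussianReal 0 1) z

end LinearField

/-!
The sum `S` is, almost surely, a weighted sum `∑ p, w p * ξ p` of the innovations, where
`w p = ∑ q ∈ Γ, a (q - p)`. Distinct `q` meet distinct entries of `a`, so `|w p| ≤ ‖a‖₁`, while
orthonormality of the innovations in `L²` gives `σ² = ∑ p, w p ^ 2`. If `κ * ‖a‖₁ ≤ σ`, the
normalized weights `w p / σ` have unit `ℓ²` norm and are all at most `1 / κ` in modulus: no single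
innovation matters, and the sum is nearly normal as in Lindeberg's theorem.

Quantitatively, a law with mean `0`, variance `1` and second moment at most `η` outside `[-c, c]`
has a characteristic function within `u² (4c|u| + 4η + u²)` of `exp (-u²/2)`
(`norm_charFun_sub_gaussian_le`). By independence the errors of the factors add up, and since the
squared normalized weights sum to `1`, on `|t| ≤ T` the characteristic function of `S / σ` is
within `T² (4cd + 4η + d²)` of the Gaussian one as soon as all `|w p / σ * t|` are at most `d`
(`LinearField.norm_charFun_normalized_sub_le`). The bound sees the law only through `c` and `η`,
which uniform integrability of the squares provides for the whole class at once.

A characteristic function close to that of a law without atoms on a large interval forces uniform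
closeness of the distribution functions (`exists_cdf_close_of_charFun_close`). This is a
compactness argument: a sequence of counterexamples would converge weakly by Lévy's theorem, and
pointwise convergence of distribution functions to a continuous one is uniform.
-/

/-! ### From characteristic functions to distribution functions -/

/-- **Pólya's theorem**: monotone functions with values in `[0, 1]` that converge pointwise to a
continuous distribution function converge uniformly. Compactness of `[A, B]` reduces the claim to
short intervals, and outside `[A, B]` the limit is within `ε / 2` of `0` or `1`. -/
lemma eventually_forall_abs_sub_le_of_monotone {F : ℕ → ℝ → ℝ} {Ψ : ℝ → ℝ}
    (hF : ∀ n, Monotone (F n)) (hF0 : ∀ n x, 0 ≤ F n x) (hF1 : ∀ n x, F n x ≤ 1)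
    (hΨ : Monotone Ψ) (hΨc : Continuous Ψ)
    (hbot : Tendsto Ψ atBot (𝓝 0)) (htop : Tendsto Ψ atTop (𝓝 1))
    (hlim : ∀ x, Tendsto (fun n => F n x) atTop (𝓝 (Ψ x))) {ε : ℝ} (hε : 0 < ε) :
    ∀ᶠ n in atTop, ∀ z, |F n z - Ψ z| ≤ ε := by
  have hΨ0 : ∀ x, 0 ≤ Ψ x := fun x => hΨ.le_of_tendsto hbot x
  have hΨ1 : ∀ x, Ψ x ≤ 1 := fun x => hΨ.ge_of_tendsto htop x
  have hclose : ∀ x, ∀ᶠ n in atTop, |F n x - Ψ x| < ε / 2 := fun x => by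
    simpa [Real.dist_eq] using (Metric.tendsto_nhds.mp (hlim x)) (ε / 2) (by positivity)
  obtain ⟨A, hA⟩ := (hbot.eventually_lt_const (show (0 : ℝ) < ε / 2 by positivity)).exists
  obtain ⟨B, hB⟩ := (htop.eventually_const_lt (show 1 - ε / 2 < (1 : ℝ) by linarith)).exists
  have hmid : ∀ᶠ n in atTop, ∀ z ∈ Set.Icc A B, |F n z - Ψ z| ≤ ε := by
    refine isCompact_Icc.induction_on (p := fun s => ∀ᶠ n in atTop, ∀ z ∈ s, |F n z - Ψ z| ≤ ε)
      (by simp) (fun s t hst ht => ht.mono fun n hn z hz => hn z (hst hz))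
      (fun s t hs ht => ?_) fun x _ => ?_
    · filter_upwards [hs, ht] with n h1 h2 z hz
      exact hz.elim (h1 z) (h2 z)
    · obtain ⟨δ, hδ, hx⟩ := Metric.continuous_iff.mp hΨc x (ε / 4) (by positivity)
      refine ⟨Set.Icc (x - δ / 2) (x + δ / 2), mem_nhdsWithin_of_mem_nhds
        (Icc_mem_nhds (by linarith) (by linarith)), ?_⟩
      have h1 := hx (x - δ / 2) (by rw [Real.dist_eq]; rw [abs_lt]; constructor <;> linarith)
      have h2 := hx (x + δ / 2) (by rw [Real.dist_eq]; rw [abs_lt]; constructor <;> linarith)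
      rw [Real.dist_eq, abs_lt] at h1 h2
      filter_upwards [hclose (x - δ / 2), hclose (x + δ / 2)] with n hn1 hn2 z hz
      rw [abs_lt] at hn1 hn2
      have := hF n hz.1
      have := hF n hz.2
      have := hΨ hz.1
      have := hΨ hz.2
      rw [abs_le]
      constructor <;> linarith [hn1.1, hn1.2, hn2.1, hn2.2, h1.1, h1.2, h2.1, h2.2]
  filter_upwards [hmid, hclose A, hclose B] with n hn hnA hnB z
  rw [abs_lt] at hnA hnB
  have h0 := hF0 n z
  have h1 := hF1 n z
  have h2 := hΨ0 z
  have h3 := hΨ1 z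
  rcases le_total z A with hz | hz
  · have := hF n hz
    have := hΨ hz
    rw [abs_le]; constructor <;> linarith [hnA.1, hnA.2]
  rcases le_total z B with hz' | hz'
  · exact hn z ⟨hz, hz'⟩
  · have := hF n hz'
    have := hΨ hz'
    rw [abs_le]; constructor <;> linarith [hnB.1, hnB.2]

lemma continuous_cdf (μ : Measure ℝ) [IsProbabilityMeasure μ] [NullSingletonClass μ] :
    Continuous (cdf μ) := by
  refine continuous_iff_continuousAt.mpr fun x => ?_
  rw [(monotone_cdf μ).continuousAt_iff_leftLim_eq_rightLim, (cdf μ).rightLim_eq]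
  have h := (cdf μ).measure_singleton x
  rw [measure_cdf, measure_singleton] at h
  -- The jump of the distribution function at `x` is the mass of the atom at `x`.
  have h' := ENNReal.ofReal_eq_zero.mp h.symm
  exact le_antisymm ((monotone_cdf μ).leftLim_le le_rfl) (by linarith)

/-- The modulus `(δ, T)` depends on `μ₀` and `ε` only. It comes from a sequence of counterexamples
with `δ → 0` and `T → ∞`, hence is not explicit. -/
lemma exists_cdf_close_of_charFun_close (μ₀ : Measure ℝ) [IsProbabilityMeasure μ₀]
    [NullSingletonClass μ₀]
    {ε : ℝ} (hε : 0 < ε) :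
    ∃ δ > 0, ∃ T > 0, ∀ (μ : Measure ℝ) [IsProbabilityMeasure μ],
      (∀ t, |t| ≤ T → ‖charFun μ t - charFun μ₀ t‖ ≤ δ) → ∀ z, |cdf μ z - cdf μ₀ z| ≤ ε := by
  by_contra! hcon
  have hpos : ∀ n : ℕ, (0 : ℝ) < 1 / (n + 1) := fun n => by positivity
  choose μ hμ hchar z hz using fun n : ℕ => hcon (1 / ((n : ℝ) + 1)) (hpos n) ((n : ℝ) + 1)
    (by positivity)
  let ν₀ : ProbabilityMeasure ℝ := ⟨μ₀, inferInstance⟩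
  let ν : ℕ → ProbabilityMeasure ℝ := fun n => ⟨μ n, hμ n⟩
  have hweak : Tendsto ν atTop (𝓝 ν₀) := by
    refine ProbabilityMeasure.tendsto_of_tendsto_charFun fun t => ?_
    rw [tendsto_iff_norm_sub_tendsto_zero]
    refine squeeze_zero' (Eventually.of_forall fun _ => norm_nonneg _) ?_
      (tendsto_one_div_add_atTop_nhds_zero_nat (𝕜 := ℝ))
    obtain ⟨N, hN⟩ := exists_nat_ge |t|
    filter_upwards [eventually_ge_atTop N] with n hn
    refine hchar n t (hN.trans ?_)
    have : (N : ℝ) ≤ n := by exact_mod_cast hn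
    linarith
  have hlim : ∀ x, Tendsto (fun n => cdf (μ n) x) atTop (𝓝 (cdf μ₀ x)) := fun x => by
    have h := ProbabilityMeasure.tendsto_measure_of_null_frontier_of_tendsto' hweak
      (E := Set.Iic x) (by simp [ν₀])
    have h' := (ENNReal.tendsto_toReal (measure_ne_top (ν₀ : Measure ℝ) _)).comp h
    simp only [cdf_eq_real]
    exact h'
  obtain ⟨n, hn⟩ := (eventually_forall_abs_sub_le_of_monotone (fun n => monotone_cdf (μ n))
    (fun n => cdf_nonneg _) (fun n => cdf_le_one _) (monotone_cdf μ₀) (continuous_cdf μ₀)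
    (tendsto_cdf_atBot _) (tendsto_cdf_atTop _) hlim hε).exists
  exact absurd (hn (z n)) (not_le.mpr (hz n))

/-! ### The Lindeberg bound for characteristic functions -/

lemma norm_prod_sub_prod_le_sum {ι : Type*} (s : Finset ι) {f g : ι → ℂ}
    (hf : ∀ i, ‖f i‖ ≤ 1) (hg : ∀ i, ‖g i‖ ≤ 1) :
    ‖∏ i ∈ s, f i - ∏ i ∈ s, g i‖ ≤ ∑ i ∈ s, ‖f i - g i‖ := by
  classical
  induction s using Finset.induction_on with
  | empty => simp
  | insert i s hi ih =>
    rw [Finset.prod_insert hi, Finset.prod_insert hi, Finset.sum_insert hi]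
    have hP : ‖∏ j ∈ s, f j‖ ≤ 1 := by
      rw [norm_prod]; exact Finset.prod_le_one (fun _ _ => norm_nonneg _) fun j _ => hf j
    calc ‖f i * ∏ j ∈ s, f j - g i * ∏ j ∈ s, g j‖
        = ‖(f i - g i) * ∏ j ∈ s, f j + g i * (∏ j ∈ s, f j - ∏ j ∈ s, g j)‖ := by ring_nf
      _ ≤ ‖f i - g i‖ * ‖∏ j ∈ s, f j‖ + ‖g i‖ * ‖∏ j ∈ s, f j - ∏ j ∈ s, g j‖ := by
          simpa only [norm_mul] using norm_add_le ((f i - g i) * ∏ j ∈ s, f j)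
            (g i * (∏ j ∈ s, f j - ∏ j ∈ s, g j))
      _ ≤ ‖f i - g i‖ * 1 + 1 * ∑ j ∈ s, ‖f j - g j‖ := by
          gcongr
          exact hg i
      _ = _ := by ring

lemma norm_exp_mul_I_sub_taylor_le (x : ℝ) :
    ‖Complex.exp (x * Complex.I) - (1 + x * Complex.I - x ^ 2 / 2)‖
      ≤ 4 * min (x ^ 2) (|x| ^ 3) := by
  rcases le_or_gt |x| 1 with hx | hx
  · have h := Complex.exp_bound (x := x * Complex.I) (n := 3) (by simpa using hx) (by norm_num)
    have hs : ∑ m ∈ Finset.range 3, ((x : ℂ) * Complex.I) ^ m / (m.factorial : ℂ)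
        = 1 + x * Complex.I - x ^ 2 / 2 := by
      simp [Finset.sum_range_succ, mul_pow, Nat.factorial]; ring
    rw [hs] at h
    have hn : ‖(x : ℂ) * Complex.I‖ = |x| := by simp
    rw [hn] at h
    norm_num [Nat.factorial] at h
    have h0 := abs_nonneg x
    have h3 : |x| ^ 3 ≤ x ^ 2 := by
      rw [← sq_abs x]; exact pow_le_pow_of_le_one h0 hx (by norm_num)
    rw [min_eq_right h3]
    have : 0 ≤ |x| ^ 3 := by positivity
    linarith
  · have h3 : x ^ 2 ≤ |x| ^ 3 := by
      rw [← sq_abs x]; exact pow_le_pow_right₀ hx.le (by norm_num)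
    rw [min_eq_left h3]
    have h1 : ‖Complex.exp (x * Complex.I) - (1 + x * Complex.I - x ^ 2 / 2)‖
        ≤ 1 + (1 + |x| + x ^ 2 / 2) := by
      refine (norm_sub_le _ _).trans ?_
      rw [Complex.norm_exp_ofReal_mul_I]
      gcongr
      refine (norm_sub_le _ _).trans ?_
      gcongr
      · refine (norm_add_le _ _).trans ?_
        simp
      · simp
    have : |x| ≤ x ^ 2 := by rw [← sq_abs x]; nlinarith
    linarith

lemma abs_exp_neg_sub_le_sq {v : ℝ} (hv : 0 ≤ v) : |Real.exp (-v) - (1 - v)| ≤ v ^ 2 := by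
  have h1 : 1 - v ≤ Real.exp (-v) := Real.one_sub_le_exp_neg v
  rw [abs_of_nonneg (by linarith)]
  rcases le_or_gt v 1 with h | h
  · have := Real.norm_exp_sub_one_sub_id_le (x := -v) (by simpa [abs_of_nonneg hv] using h)
    rw [Real.norm_eq_abs, Real.norm_eq_abs, abs_neg, sq_abs] at this
    linarith [le_abs_self (Real.exp (-v) - 1 - -v)]
  · have : Real.exp (-v) ≤ 1 := Real.exp_le_one_iff.mpr (by linarith)
    nlinarith

/-- The Lindeberg estimate for one factor. On `|x| ≤ c` the cubic Taylor bound
`|u x| ^ 3 ≤ c |u| ^ 3 x ^ 2` is used, on `c < |x|` the quadratic one. -/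
lemma norm_charFun_sub_gaussian_le {ν : Measure ℝ} [IsProbabilityMeasure ν]
    (hint : Integrable (fun x : ℝ => x ^ 2) ν) (hmean : ∫ x, x ∂ν = 0)
    (hvar : ∫ x, x ^ 2 ∂ν = 1) {c η : ℝ} (hc : 0 ≤ c)
    (htail : ∫ x in {x : ℝ | c < |x|}, x ^ 2 ∂ν ≤ η) (u : ℝ) :
    ‖charFun ν u - Complex.exp (-(u ^ 2 / 2))‖ ≤ u ^ 2 * (4 * c * |u| + 4 * η + u ^ 2) := by
  have hint1 : Integrable (fun x : ℝ => x) ν :=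
    ((memLp_two_iff_integrable_sq measurable_id.aestronglyMeasurable).mpr hint).integrable
      one_le_two
  have hmeas : MeasurableSet {x : ℝ | c < |x|} := measurableSet_lt measurable_const measurable_norm
  have hexp : Integrable (fun x : ℝ => Complex.exp (((u * x : ℝ) : ℂ) * Complex.I)) ν := by
    refine Integrable.of_bound (C := 1) (by fun_prop) (Eventually.of_forall fun x => ?_)
    rw [Complex.norm_exp_ofReal_mul_I]
  have hi1 : Integrable (fun x : ℝ => ((u * x : ℝ) : ℂ) * Complex.I) ν :=
    ((hint1.const_mul u).ofReal).mul_const _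
  have hi01 : Integrable (fun x : ℝ => 1 + ((u * x : ℝ) : ℂ) * Complex.I) ν :=
    (integrable_const _).add hi1
  have hi2 : Integrable (fun x : ℝ => ((u * x : ℝ) : ℂ) ^ 2 / 2) ν := by
    have : Integrable (fun x : ℝ => ((u ^ 2 / 2 * x ^ 2 : ℝ) : ℂ)) ν :=
      (hint.const_mul (u ^ 2 / 2)).ofReal
    refine this.congr (Eventually.of_forall fun x => ?_)
    push_cast; ring
  have hpint : Integrable
      (fun x : ℝ => 1 + ((u * x : ℝ) : ℂ) * Complex.I - ((u * x : ℝ) : ℂ) ^ 2 / 2) ν :=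
    hi01.sub hi2
  have hpoly : ∫ x, (1 + ((u * x : ℝ) : ℂ) * Complex.I - ((u * x : ℝ) : ℂ) ^ 2 / 2) ∂ν
      = 1 - (u : ℂ) ^ 2 / 2 := by
    have e1 : ∫ x, ((u * x : ℝ) : ℂ) * Complex.I ∂ν = 0 := by
      rw [integral_mul_const, integral_complex_ofReal, integral_const_mul, hmean]; simp
    have e2 : ∫ x, ((u * x : ℝ) : ℂ) ^ 2 / 2 ∂ν = (u : ℂ) ^ 2 / 2 := by
      have : ∀ x : ℝ, ((u * x : ℝ) : ℂ) ^ 2 / 2 = ((u ^ 2 / 2 * x ^ 2 : ℝ) : ℂ) := fun x => by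
        push_cast; ring
      simp_rw [this]
      rw [integral_complex_ofReal, integral_const_mul, hvar]; simp
    rw [integral_sub hi01 hi2, integral_add (integrable_const _) hi1,
      e1, e2]
    simp
  have htaylor : ‖charFun ν u - (1 - (u : ℂ) ^ 2 / 2)‖ ≤ 4 * c * |u| ^ 3 + 4 * u ^ 2 * η := by
    have hint' := hint.indicator hmeas
    have hcf : charFun ν u = ∫ x, Complex.exp (((u * x : ℝ) : ℂ) * Complex.I) ∂ν := by
      rw [charFun_apply_real]; simp
    rw [hcf, ← hpoly, ← integral_sub hexp hpint]
    calc _ ≤ ∫ x, (4 * c * |u| ^ 3 * x ^ 2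
            + 4 * u ^ 2 * {x : ℝ | c < |x|}.indicator (fun x => x ^ 2) x) ∂ν := by
          refine norm_integral_le_of_norm_le
            ((hint.const_mul _).add (hint'.const_mul _)) (Eventually.of_forall fun x => ?_)
          refine (norm_exp_mul_I_sub_taylor_le (u * x)).trans ?_
          by_cases hx : c < |x|
          · rw [Set.indicator_of_mem (show x ∈ {x : ℝ | c < |x|} from hx)]
            have : 0 ≤ 4 * c * |u| ^ 3 * x ^ 2 := by positivity
            have := min_le_left ((u * x) ^ 2) (|u * x| ^ 3)
            nlinarith
          · rw [Set.indicator_of_notMem (show x ∉ {x : ℝ | c < |x|} from hx)]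
            have h1 := min_le_right ((u * x) ^ 2) (|u * x| ^ 3)
            have h2 : |u * x| ^ 3 ≤ |u| ^ 3 * (c * x ^ 2) := by
              rw [abs_mul, mul_pow]
              gcongr
              rw [pow_succ, sq_abs, mul_comm]
              gcongr
              exact not_lt.mp hx
            linarith
      _ = 4 * c * |u| ^ 3 + 4 * u ^ 2 * ∫ x in {x : ℝ | c < |x|}, x ^ 2 ∂ν := by
          rw [integral_add (hint.const_mul _) (hint'.const_mul _), integral_const_mul,
            integral_const_mul, hvar, integral_indicator hmeas, mul_one]
      _ ≤ _ := by gcongr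
  have hgauss : ‖(1 - (u : ℂ) ^ 2 / 2) - Complex.exp (-(u ^ 2 / 2))‖ ≤ (u ^ 2 / 2) ^ 2 := by
    have h := abs_exp_neg_sub_le_sq (v := u ^ 2 / 2) (by positivity)
    rw [← Real.norm_eq_abs, ← Complex.norm_real] at h
    push_cast at h
    rw [norm_sub_rev] at h
    exact h
  have h3 : |u| ^ 3 = u ^ 2 * |u| := by rw [pow_succ, sq_abs]
  calc _ = ‖(charFun ν u - (1 - (u : ℂ) ^ 2 / 2))
            + ((1 - (u : ℂ) ^ 2 / 2) - Complex.exp (-(u ^ 2 / 2)))‖ := by ring_nf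
    _ ≤ 4 * c * |u| ^ 3 + 4 * u ^ 2 * η + (u ^ 2 / 2) ^ 2 :=
        (norm_add_le _ _).trans (add_le_add htaylor hgauss)
    _ ≤ _ := by rw [h3]; nlinarith [sq_nonneg (u ^ 2)]

/-! ### Weighted sums of independent variables -/

section WeightedSums

variable {ι Ω : Type*} [Countable ι] [MeasurableSpace Ω] {P : Measure Ω} [IsProbabilityMeasure P]
  {ξ : ι → Ω → ℝ} {b : ι → ℝ}

lemma integral_abs_le_one {X : Ω → ℝ} (hX : MemLp X 2 P) (h1 : ∫ ω, X ω ^ 2 ∂P = 1) :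
    ∫ ω, |X ω| ∂P ≤ 1 := by
  have h : ∫ ω, |X ω| ∂P ≤ ∫ ω, (1 + X ω ^ 2) / 2 ∂P := by
    refine integral_mono (hX.integrable one_le_two).abs
      (((integrable_const _).add hX.integrable_sq).div_const 2) fun ω => ?_
    have := sq_nonneg (|X ω| - 1)
    have := sq_abs (X ω)
    simp only
    nlinarith
  rw [integral_div, integral_add (integrable_const _) hX.integrable_sq, h1] at h
  simpa using h

lemma ae_summable_abs_mul (hb : Summable fun p => |b p|) (hL : ∀ p, MemLp (ξ p) 2 P)
    (h1 : ∀ p, ∫ ω, ξ p ω ^ 2 ∂P = 1) :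
    ∀ᵐ ω ∂P, Summable fun p => |b p * ξ p ω| := by
  have hint : ∀ p, Integrable (fun ω => b p * ξ p ω) P := fun p =>
    ((hL p).integrable one_le_two).const_mul _
  have hfin : ∫⁻ ω, ∑' p, ‖b p * ξ p ω‖ₑ ∂P ≠ ⊤ := by
    rw [lintegral_tsum fun p => (hint p).1.enorm]
    have hle : ∀ p, ∫⁻ ω, ‖b p * ξ p ω‖ₑ ∂P ≤ ENNReal.ofReal |b p| := fun p => by
      rw [← ofReal_integral_norm_eq_lintegral_enorm (hint p)]
      refine ENNReal.ofReal_le_ofReal ?_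
      simp_rw [norm_mul, Real.norm_eq_abs]
      rw [integral_const_mul]
      exact mul_le_of_le_one_right (abs_nonneg _) (integral_abs_le_one (hL p) (h1 p))
    exact ne_top_of_le_ne_top hb.tsum_ofReal_ne_top (ENNReal.tsum_le_tsum hle)
  filter_upwards [ae_lt_top' (AEMeasurable.tsum fun p => (hint p).1.enorm) hfin] with ω hω
  have := ENNReal.summable_toReal hω.ne
  simpa using this

lemma aemeasurable_tsum_mul (hb : Summable fun p => |b p|) (hL : ∀ p, MemLp (ξ p) 2 P)
    (h1 : ∀ p, ∫ ω, ξ p ω ^ 2 ∂P = 1) :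
    AEMeasurable (fun ω => ∑' p, b p * ξ p ω) P := by
  refine aemeasurable_of_tendsto_metrizable_ae (atTop : Filter (Finset ι))
    (f := fun s ω => ∑ p ∈ s, b p * ξ p ω) (fun s => ?_) ?_
  · exact Finset.aemeasurable_fun_sum _ fun p _ => (hL p).1.aemeasurable.const_mul _
  · filter_upwards [ae_summable_abs_mul hb hL h1] with ω hω
    exact hω.of_abs.hasSum

/-- Parseval's identity for independent standardized variables; the square of the series is
expanded as a double series that converges absolutely in `L¹`. -/
lemma integral_sq_tsum_mul (hind : iIndepFun ξ P) (hb : Summable fun p => |b p|)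
    (hL : ∀ p, MemLp (ξ p) 2 P) (h0 : ∀ p, ∫ ω, ξ p ω ∂P = 0)
    (h1 : ∀ p, ∫ ω, ξ p ω ^ 2 ∂P = 1) :
    ∫ ω, (∑' p, b p * ξ p ω) ^ 2 ∂P = ∑' p, b p ^ 2 := by
  classical
  have hint : ∀ z : ι × ι, Integrable (fun ω => (b z.1 * ξ z.1 ω) * (b z.2 * ξ z.2 ω)) P :=
    fun z => ((hL z.1).const_mul (b z.1)).integrable_mul ((hL z.2).const_mul (b z.2))
  have hnorm : ∀ z : ι × ι, ∫ ω, ‖(b z.1 * ξ z.1 ω) * (b z.2 * ξ z.2 ω)‖ ∂P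
      ≤ |b z.1| * |b z.2| := fun z => by
    have hle : ∫ ω, ‖(b z.1 * ξ z.1 ω) * (b z.2 * ξ z.2 ω)‖ ∂P
        ≤ ∫ ω, |b z.1| * |b z.2| * ((ξ z.1 ω ^ 2 + ξ z.2 ω ^ 2) / 2) ∂P := by
      refine integral_mono (hint z).norm
        ((((hL z.1).integrable_sq.add (hL z.2).integrable_sq).div_const 2).const_mul _)
        fun ω => ?_
      -- `|ξ ξ'| ≤ (ξ² + ξ'²) / 2`, so every mixed moment is at most `1`.
      have h := two_mul_le_add_sq |ξ z.1 ω| |ξ z.2 ω|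
      rw [sq_abs, sq_abs] at h
      simp only [norm_mul, Real.norm_eq_abs]
      calc |b z.1| * |ξ z.1 ω| * (|b z.2| * |ξ z.2 ω|)
          = |b z.1| * |b z.2| * (|ξ z.1 ω| * |ξ z.2 ω|) := by ring
        _ ≤ _ := by gcongr; linarith
    rw [integral_const_mul, integral_div,
      integral_add (hL z.1).integrable_sq (hL z.2).integrable_sq, h1, h1] at hle
    linarith
  have hsum : Summable fun z : ι × ι => ∫ ω, ‖(b z.1 * ξ z.1 ω) * (b z.2 * ξ z.2 ω)‖ ∂P :=
    Summable.of_nonneg_of_le (fun z => integral_nonneg fun _ => norm_nonneg _) hnorm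
      (hb.mul_of_nonneg hb (fun _ => abs_nonneg _) fun _ => abs_nonneg _)
  have hval : ∀ z : ι × ι, ∫ ω, (b z.1 * ξ z.1 ω) * (b z.2 * ξ z.2 ω) ∂P
      = if z.1 = z.2 then b z.1 ^ 2 else 0 := fun z => by
    have e : ∀ ω, (b z.1 * ξ z.1 ω) * (b z.2 * ξ z.2 ω)
        = b z.1 * b z.2 * (ξ z.1 ω * ξ z.2 ω) := fun ω => by ring
    simp_rw [e]
    rw [integral_const_mul]
    split_ifs with h
    · rw [← h]
      simp_rw [← pow_two]
      rw [h1, mul_one]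
    · rw [(hind.indepFun h).integral_fun_mul_eq_mul_integral (hL z.1).1 (hL z.2).1, h0]
      simp
  have hS := hasSum_integral_of_summable_integral_norm hint hsum
  simp_rw [hval] at hS
  have hcongr : ∫ ω, (∑' p, b p * ξ p ω) ^ 2 ∂P
      = ∫ ω, ∑' z : ι × ι, (b z.1 * ξ z.1 ω) * (b z.2 * ξ z.2 ω) ∂P := by
    refine integral_congr_ae ?_
    filter_upwards [ae_summable_abs_mul hb hL h1] with ω hω
    rw [pow_two]
    exact tsum_mul_tsum_of_summable_norm hω hω
  have hdiag : Function.Injective fun p : ι => (p, p) := fun p q h => congrArg Prod.fst h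
  rw [hcongr, ← hS.tsum_eq, ← hdiag.tsum_eq]
  · simp
  · intro z hz
    simp only [Function.mem_support, ne_eq, ite_eq_right_iff, not_forall] at hz
    exact ⟨z.1, Prod.ext rfl hz.1⟩

/-- If each factor is Gaussian up to an error `B` times its variance `(b p * t) ^ 2`, then the whole
weighted sum is Gaussian up to `B` times its total variance, because the errors add up. The product
bound is applied to finite partial sums, and the limit is taken by dominated
convergence. -/
lemma norm_charFun_tsum_mul_sub_le (hind : iIndepFun ξ P) (hb : Summable fun p => |b p|)
    (hL : ∀ p, MemLp (ξ p) 2 P) (h1 : ∀ p, ∫ ω, ξ p ω ^ 2 ∂P = 1) (t : ℝ) {B : ℝ}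
    (hB : 0 ≤ B)
    (hfac : ∀ p, ‖charFun (P.map (ξ p)) (b p * t) - Complex.exp (-(((b p * t : ℝ) : ℂ) ^ 2 / 2))‖
      ≤ (b p * t) ^ 2 * B) :
    ‖charFun (P.map fun ω => ∑' p, b p * ξ p ω) t
      - Complex.exp (-((∑' p, b p ^ 2 : ℝ) * t ^ 2 / 2))‖ ≤ (∑' p, b p ^ 2) * t ^ 2 * B := by
  have hb2 : Summable fun p => b p ^ 2 := by
    have := hb.mul_of_nonneg hb (fun _ => abs_nonneg _) fun _ => abs_nonneg _
    have := this.comp_injective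
      (i := fun p : ι => (p, p)) fun p q h => congrArg Prod.fst h
    refine this.congr fun p => ?_
    simp [← sq]
  have hmeas : ∀ s : Finset ι, AEMeasurable (fun ω => ∑ p ∈ s, b p * ξ p ω) P := fun s =>
    Finset.aemeasurable_fun_sum _ fun p _ => (hL p).1.aemeasurable.const_mul _
  have hfin : ∀ s : Finset ι, charFun (P.map fun ω => ∑ p ∈ s, b p * ξ p ω) t
      = ∏ p ∈ s, charFun (P.map (ξ p)) (b p * t) := fun s => by
    have hind' : iIndepFun (fun p ω => b p * ξ p ω) P :=
      hind.comp (fun p x => b p * x) fun p => by fun_prop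
    rw [(hind'.restrict s).charFun_map_fun_finsetSum_eq_prod
      fun p _ => (hL p).1.aemeasurable.const_mul _, Finset.prod_apply]
    refine Finset.prod_congr rfl fun p _ => ?_
    rw [charFun_map_mul_comp (hL p).1.aemeasurable]
  have hlim : Tendsto (fun s : Finset ι => charFun (P.map fun ω => ∑ p ∈ s, b p * ξ p ω) t) atTop
      (𝓝 (charFun (P.map fun ω => ∑' p, b p * ξ p ω) t)) := by
    have e : ∀ X : Ω → ℝ, AEMeasurable X P →
        charFun (P.map X) t = ∫ ω, Complex.exp (t * X ω * Complex.I) ∂P := fun X hX => by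
      rw [charFun_apply_real, integral_map hX (by fun_prop)]
    simp_rw [fun s => e _ (hmeas s), e _ (aemeasurable_tsum_mul hb hL h1)]
    refine tendsto_integral_filter_of_dominated_convergence (fun _ => 1)
      (Eventually.of_forall fun s => ?_) (Eventually.of_forall fun s =>
        Eventually.of_forall fun ω => ?_) (integrable_const _) ?_
    · have := hmeas s
      exact AEMeasurable.aestronglyMeasurable (by fun_prop)
    · rw [← Complex.ofReal_mul, Complex.norm_exp_ofReal_mul_I]
    · filter_upwards [ae_summable_abs_mul hb hL h1] with ω hω
      have hc : Continuous fun y : ℝ => Complex.exp (t * y * Complex.I) := by fun_prop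
      exact (hc.tendsto _).comp hω.of_abs.hasSum
  have hlim' : Tendsto (fun s : Finset ι => ∏ p ∈ s,
      Complex.exp (-(((b p * t : ℝ) : ℂ) ^ 2 / 2))) atTop
      (𝓝 (Complex.exp (-((∑' p, b p ^ 2 : ℝ) * t ^ 2 / 2)))) := by
    have hc : Continuous fun y : ℝ => Complex.exp (-((y : ℂ) * t ^ 2 / 2)) := by fun_prop
    refine ((hc.tendsto _).comp hb2.hasSum).congr fun s => ?_
    rw [← Complex.exp_sum]
    simp only [Function.comp]
    congr 1
    push_cast
    rw [Finset.sum_neg_distrib, ← Finset.sum_div, Finset.sum_mul]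
    congr 3 with p
    ring
  refine le_of_tendsto (hlim.sub hlim').norm (Eventually.of_forall fun s => ?_)
  rw [hfin]
  refine (norm_prod_sub_prod_le_sum s (fun p => ?_) fun p => ?_).trans ?_
  · have := Measure.isProbabilityMeasure_map (hL p).1.aemeasurable
    exact norm_charFun_le_one _
  · rw [Complex.norm_exp]
    have : (-(((b p * t : ℝ) : ℂ) ^ 2 / 2)).re = -((b p * t) ^ 2 / 2) := by
      rw [← Complex.ofReal_re (-((b p * t) ^ 2 / 2))]; push_cast; rfl
    rw [this]
    exact Real.exp_le_one_iff.mpr (by have := sq_nonneg (b p * t); linarith)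
  · calc _ ≤ ∑ p ∈ s, (b p * t) ^ 2 * B := Finset.sum_le_sum fun p _ => hfac p
      _ = (∑ p ∈ s, b p ^ 2) * t ^ 2 * B := by simp_rw [mul_pow, Finset.sum_mul]
      _ ≤ _ := by
        gcongr
        exact hb2.sum_le_tsum _ fun _ _ => sq_nonneg _

end WeightedSums

/-! ### The sum of a linear field as a weighted sum of innovations -/

namespace LinearField

/-- The coefficient of the innovation `ξ p` in the sum of the linear field over `Γ`. -/
noncomputable def weight (a : ℤ × ℤ → ℝ) (Γ : Finset (ℤ × ℤ)) (p : ℤ × ℤ) : ℝ :=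
  ∑ q ∈ Γ, a (q - p)

lemma summable_abs_sub_left {a : ℤ × ℤ → ℝ} (ha : Summable fun p => |a p|) (q : ℤ × ℤ) :
    Summable fun p => |a (q - p)| :=
  (Equiv.subLeft q).summable_iff.mpr ha

lemma summable_abs_weight {a : ℤ × ℤ → ℝ} (ha : Summable fun p => |a p|) (Γ : Finset (ℤ × ℤ)) :
    Summable fun p => |weight a Γ p| :=
  Summable.of_nonneg_of_le (fun _ => abs_nonneg _) (fun _ => Finset.abs_sum_le_sum_abs _ _)
    (summable_sum fun q _ => summable_abs_sub_left ha q)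

lemma abs_weight_le_l1Norm {a : ℤ × ℤ → ℝ} (ha : Summable fun p => |a p|) (Γ : Finset (ℤ × ℤ))
    (p : ℤ × ℤ) : |weight a Γ p| ≤ l1Norm a := by
  have hs : Summable fun q => |a (q - p)| := (Equiv.subRight p).summable_iff.mpr ha
  calc |weight a Γ p| ≤ ∑ q ∈ Γ, |a (q - p)| := Finset.abs_sum_le_sum_abs _ _
    _ ≤ ∑' q, |a (q - p)| := hs.sum_le_tsum _ fun _ _ => abs_nonneg _
    _ = l1Norm a := (Equiv.subRight p).tsum_eq fun q => |a q|

variable {Ω : Type*} [MeasurableSpace Ω] {P : Measure Ω} [IsProbabilityMeasure P]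

/-- Absolute convergence, valid almost surely, allows the sum over `Γ` to be exchanged with the
series. -/
lemma S_ae_eq_tsum_weight {ξ : ℤ × ℤ → Ω → ℝ} {a : ℤ × ℤ → ℝ} (ha : Summable fun p => |a p|)
    (Γ : Finset (ℤ × ℤ)) (hL : ∀ p, MemLp (ξ p) 2 P) (h1 : ∀ p, ∫ ω, ξ p ω ^ 2 ∂P = 1) :
    S a Γ ξ =ᵐ[P] fun ω => ∑' p, weight a Γ p * ξ p ω := by
  have h : ∀ᵐ ω ∂P, ∀ q, Summable fun p => |a (q - p) * ξ p ω| :=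
    ae_all_iff.mpr fun q => ae_summable_abs_mul (summable_abs_sub_left ha q) hL h1
  filter_upwards [h] with ω hω
  have hfield : ∀ q, field a ξ q ω = ∑' p, a (q - p) * ξ p ω := fun q => by
    rw [field, ← (Equiv.subLeft q).tsum_eq]
    simp
  simp only [S, hfield, weight, Finset.sum_mul]
  exact (Summable.tsum_finsetSum fun q _ => (hω q).of_abs).symm

/-- The normalized sum is measurable up to a null set, and its characteristic function is close to
the Gaussian one on `[-T, T]`, with a bound that depends on the innovation law through `c` and `η`
only. -/
lemma norm_charFun_normalized_sub_le {ξ : ℤ × ℤ → Ω → ℝ} {ν : Measure ℝ}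
    [IsProbabilityMeasure ν] (hmeas : ∀ p, Measurable (ξ p)) (hind : iIndepFun ξ P)
    (hlaw : ∀ p, P.map (ξ p) = ν)
    (hint : Integrable (fun x : ℝ => x ^ 2) ν) (hmean : ∫ x, x ∂ν = 0)
    (hvar : ∫ x, x ^ 2 ∂ν = 1) {c η d T : ℝ} (hc : 0 ≤ c) (hη : 0 ≤ η)
    (htail : ∫ x in {x : ℝ | c < |x|}, x ^ 2 ∂ν ≤ η) (hd : 0 < d)
    {a : ℤ × ℤ → ℝ} (ha : Summable fun p => |a p|) (Γ : Finset (ℤ × ℤ))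
    (hσ : 0 < sigma a Γ ξ P) (hκ : T / d * l1Norm a ≤ sigma a Γ ξ P) :
    AEMeasurable (fun ω => S a Γ ξ ω / sigma a Γ ξ P) P ∧ ∀ t, |t| ≤ T →
      ‖charFun (P.map fun ω => S a Γ ξ ω / sigma a Γ ξ P) t - charFun (gaussianReal 0 1) t‖
        ≤ T ^ 2 * (4 * c * d + 4 * η + d ^ 2) := by
  have hL : ∀ p, MemLp (ξ p) 2 P := fun p => by
    have h : MemLp (fun x : ℝ => x) 2 ν :=
      (memLp_two_iff_integrable_sq measurable_id.aestronglyMeasurable).mpr hint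
    rw [← hlaw p] at h
    exact h.comp_of_map (hmeas p).aemeasurable
  have h0 : ∀ p, ∫ ω, ξ p ω ∂P = 0 := fun p => by
    rw [← hmean, ← hlaw p, integral_map (hmeas p).aemeasurable (by fun_prop)]
  have h1 : ∀ p, ∫ ω, ξ p ω ^ 2 ∂P = 1 := fun p => by
    rw [← hvar, ← hlaw p, integral_map (hmeas p).aemeasurable (by fun_prop)]
  set σ := sigma a Γ ξ P with hσdef
  have hS := S_ae_eq_tsum_weight ha Γ hL h1
  have hw := summable_abs_weight ha Γ
  have hσsq : σ ^ 2 = ∑' p, weight a Γ p ^ 2 := by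
    rw [hσdef, sigma, Real.sq_sqrt (integral_nonneg fun _ => sq_nonneg _),
      ← integral_sq_tsum_mul hind hw hL h0 h1]
    refine integral_congr_ae ?_
    filter_upwards [hS] with ω hω
    rw [hω]
  have hb : Summable fun p => |weight a Γ p / σ| := by
    simp_rw [abs_div]
    exact hw.div_const _
  have hbsq : ∑' p, (weight a Γ p / σ) ^ 2 = 1 := by
    simp_rw [div_pow]
    rw [tsum_div_const, ← hσsq, div_self (by positivity)]
  have hSσ : (fun ω => S a Γ ξ ω / σ) =ᵐ[P] fun ω => ∑' p, weight a Γ p / σ * ξ p ω := by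
    filter_upwards [hS] with ω hω
    rw [hω, ← tsum_div_const]
    exact tsum_congr fun p => by ring
  refine ⟨(aemeasurable_tsum_mul hb hL h1).congr hSσ.symm, fun t ht => ?_⟩
  have hmax : ∀ p, |weight a Γ p / σ * t| ≤ d := fun p => by
    have h := abs_weight_le_l1Norm ha Γ p
    rw [abs_mul, abs_div, abs_of_pos hσ, div_mul_eq_mul_div, div_le_iff₀ hσ]
    rw [div_mul_eq_mul_div, div_le_iff₀ hd] at hκ
    calc |weight a Γ p| * |t| ≤ l1Norm a * T := by
          gcongr
          exact (abs_nonneg _).trans h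
      _ ≤ d * σ := by linarith
  have hd2 : ∀ {u : ℝ}, |u| ≤ d → u ^ 2 ≤ d ^ 2 := fun {u} hu => by
    rw [← sq_abs u]; gcongr
  have key := norm_charFun_tsum_mul_sub_le hind hb hL h1 t
    (B := 4 * c * d + 4 * η + d ^ 2) (by positivity) fun p => by
      rw [hlaw p]
      refine (norm_charFun_sub_gaussian_le hint hmean hvar hc htail _).trans ?_
      have h2 := hd2 (hmax p)
      have h3 := hmax p
      gcongr
  rw [hbsq] at key
  rw [Measure.map_congr hSσ, charFun_gaussianReal]
  have e : (t : ℂ) * (0 : ℝ) * Complex.I - ((1 : NNReal) : ℝ) * t ^ 2 / 2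
      = -(((1 : ℝ) : ℂ) * t ^ 2 / 2) := by push_cast; ring
  have ht2 : t ^ 2 ≤ T ^ 2 := by rw [← sq_abs t]; gcongr
  rw [e]
  refine key.trans ?_
  rw [one_mul]
  gcongr

end LinearField

/-! ### Uniformity over the class of innovation laws -/

theorem corollary1 (𝓗 : Set (StieltjesFunction ℝ))
    (h𝓗 : LinearField.IsStandardizedUniformClass 𝓗) (ε : ℝ) (hε : 0 < ε) :
    ∃ κ : ℝ, 0 < κ ∧
      ∀ (Ω : Type*) [MeasurableSpace Ω] (P : Measure Ω) [IsProbabilityMeasure P]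
        (F : StieltjesFunction ℝ) (ξ : ℤ × ℤ → Ω → ℝ)
        (a : ℤ × ℤ → ℝ) (Γ : Finset (ℤ × ℤ)),
        F ∈ 𝓗 → LinearField.IsIIDWith ξ F P →
        Summable (fun p => |a p|) →
        0 < LinearField.sigma a Γ ξ P →
        κ * LinearField.l1Norm a ≤ LinearField.sigma a Γ ξ P →
        ⨆ z : ℝ, |LinearField.G a Γ ξ P z - LinearField.Phi z| ≤ ε := by
  have : NullSingletonClass (gaussianReal 0 1) := nullSingletonClass_gaussianReal one_ne_zero
  obtain ⟨δ, hδ, T, hT, hclose⟩ := exists_cdf_close_of_charFun_close (gaussianReal 0 1) hε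
  -- The three error terms `4cd`, `4η`, `d²` are to add up to at most `δ / T²`. The tail level `η`
  -- comes first; it determines `c`, and then `d` is chosen with `4cd + d² ≤ (4c + 1) d`.
  set η : ℝ := δ / (12 * T ^ 2) with hη_def
  have hη : 0 < η := by positivity
  obtain ⟨c, hc, hctail⟩ := ((eventually_ge_atTop (0 : ℝ)).and
    (h𝓗.tendsto_tail.eventually_lt_const (ENNReal.ofReal_pos.mpr hη))).exists
  set d : ℝ := min 1 (δ / (3 * T ^ 2 * (4 * c + 1))) with hd_def
  have hd : 0 < d := lt_min one_pos (by positivity)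
  have hbound : T ^ 2 * (4 * c * d + 4 * η + d ^ 2) ≤ δ := by
    have hd1 : d ≤ 1 := min_le_left _ _
    have hd2 : d * (3 * T ^ 2 * (4 * c + 1)) ≤ δ :=
      (le_div_iff₀ (by positivity)).mp (min_le_right _ _)
    have hη' : η * (12 * T ^ 2) = δ := div_mul_cancel₀ _ (by positivity)
    have hdd : T ^ 2 * d ^ 2 ≤ T ^ 2 * d := by gcongr; nlinarith
    nlinarith
  refine ⟨T / d, by positivity, fun Ω _ P _ F ξ a Γ hF hξ ha hσ hκ => ?_⟩
  have hlaw : ∀ p, P.map (ξ p) = F.measure := fun p => by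
    have := Measure.isProbabilityMeasure_map (μ := P) (hξ.measurable p).aemeasurable
    rw [← hξ.distribution p, measure_cdf]
  have hprob : IsProbabilityMeasure F.measure :=
    hlaw 0 ▸ Measure.isProbabilityMeasure_map (hξ.measurable 0).aemeasurable
  have hvar := h𝓗.second_moment_eq_one F hF
  -- An integral equal to `1` is not the junk value of a non-integrable function.
  have hint : Integrable (fun x : ℝ => x ^ 2) F.measure :=
    Integrable.of_integral_ne_zero (by rw [hvar]; exact one_ne_zero)
  have htail : ∫ x in {x : ℝ | c < |x|}, x ^ 2 ∂F.measure ≤ η := by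
    rw [integral_eq_lintegral_of_nonneg_ae (Eventually.of_forall fun x => sq_nonneg x)
      (by fun_prop)]
    refine ENNReal.toReal_le_of_le_ofReal hη.le (le_trans ?_ hctail.le)
    exact le_iSup₂ (f := fun H (_ : H ∈ 𝓗) => LinearField.tailSecondMoment H c) F hF
  obtain ⟨hmeas, hchar⟩ := LinearField.norm_charFun_normalized_sub_le hξ.measurable hξ.indep hlaw
    hint (h𝓗.mean_eq_zero F hF) hvar hc hη.le htail hd ha Γ hσ hκ
  have := Measure.isProbabilityMeasure_map hmeas
  refine ciSup_le fun z => ?_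
  have hz := hclose _ (fun t ht => (hchar t ht).trans hbound) z
  rwa [cdf_eq_real, map_measureReal_apply_of_aemeasurable hmeas measurableSet_Iic] at hz
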